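/- Let $m,n\ge 0$ be integers. Let $\Box_m=\operatorname{conv}\{(a_1,\dots,a_m) : a_k=\pm1\}\subset\mathbb R^m$ be the standard cube and $\triangle_n=\operatorname{conv}(0,e_1,\dots,e_n)\subset\mathbb R^n$ the standard simplex. Let $\operatorname{Hom}(\Box_m,\triangle_n)$ be the set of affine maps $\Box_m\to\triangle_n$, identified with the set of those affine maps $\mathbb R^m\to\mathbb R^n$ that send $\Box_m$ into $\triangle_n$; it is a polytope in the real vector space $\operatorname{Aff}(\mathbb R^m,\mathbb R^n)$ of all affine maps $\mathbb R^m\to\mathbb R^n$. Then $\operatorname{Hom}(\Box_m,\triangle_n)$ has exactly $(n+1)(mn+1)$ vertices. Moreover, let $\mathbb R^{n+nm}$ have standard basis vectors $e_i$ and $e_{ik}$ ($1\le i\le n$, $1\le k\le m$), and let $S\subset\mathbb R^{n+nm}$ be the set consisting of the points $$0,\qquad 2e_i,\qquad e_i+e_{ik},\qquad e_i-e_{ik},\qquad (e_i+e_j)+(e_{ik}-e_{jk})\ \text{ with } i\ne j,$$ where $i,j\in\{1,\dots,n\}$ and $k\in\{1,\dots,m\}$. Then there is an affine isomorphism $\operatorname{Aff}(\mathbb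 R^m,\mathbb R^n)\to\mathbb R^{n+nm}$ that maps $\operatorname{Hom}(\Box_m,\triangle_n)$ onto $\operatorname{conv}(S)$ and maps the vertex set of $\operatorname{Hom}(\Box_m,\triangle_n)$ onto $S$. -/

import Mathlib

/-- The standard `m`-cube `□_m = conv {(a₁, …, a_m) | a_i = ±1}` in `ℝ^m`. -/
def cube (m : ℕ) : Set (Fin m → ℝ) :=
  convexHull ℝ {a | ∀ i, a i = 1 ∨ a i = -1}

/-- The standard `n`-simplex `△_n = conv (0, e₁, …, e_n)` in `ℝ^n`. -/
def simplex (n : ℕ) : Set (Fin n → ℝ) :=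
  convexHull ℝ (insert 0 (Set.range fun i : Fin n => Pi.single i (1 : ℝ)))

/-- The set `Hom(P, Q)` of affine maps `P → Q`, inside the real vector space of affine maps
`V → W` with pointwise operations, for `P ⊆ V` whose affine hull is all of `V`. For such `P` an
affine map `P → Q`, i.e. the restriction of an affine map between the ambient spaces, is the same
as an affine map `V → W` that sends `P` into `Q` (for the cube see
`eq_of_eqOn_cube` below). -/
def homPolytope {V W : Type*} [AddCommGroup V] [Module ℝ V] [AddCommGroup W] [Module ℝ W]
    (P : Set V) (Q : Set W) : Set (V →ᵃ[ℝ] W) :=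
  {f | Set.MapsTo f P Q}

/-- An affine map on `ℝ^m` is determined by its restriction to the cube. -/
theorem eq_of_eqOn_cube {m : ℕ} {W : Type*} [AddCommGroup W] [Module ℝ W]
    {f g : (Fin m → ℝ) →ᵃ[ℝ] W} (h : Set.EqOn f g (cube m)) : f = g := by
  have h1 : f (fun _ => 1) = g (fun _ => 1) :=
    h (subset_convexHull ℝ _ fun i => Or.inl rfl)
  have hlin : f.linear = g.linear := by
    refine (Pi.basisFun ℝ (Fin m)).ext fun i => ?_
    have h2 : f (Function.update (fun _ => 1) i (-1)) = g (Function.update (fun _ => 1) i (-1)) := by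
      refine h (subset_convexHull ℝ _ fun j => ?_)
      by_cases hj : j = i
      · subst hj; simp
      · simp [hj]
    have e : Pi.basisFun ℝ (Fin m) i = (2⁻¹ : ℝ) •
        ((fun _ => (1 : ℝ)) -ᵥ Function.update (fun _ => (1 : ℝ)) i (-1)) := by
      ext j
      by_cases hj : j = i
      · subst hj; simp; norm_num
      · simp [hj]
    rw [e, map_smul, map_smul, AffineMap.linearMap_vsub, AffineMap.linearMap_vsub, h1, h2]
  exact AffineMap.ext_linear hlin h1

/-- The vertices of a polytope are its extreme points; `vert m n` is the set of vertices of
`Hom(□_m, △_n)`. -/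
def vert (m n : ℕ) : Set ((Fin m → ℝ) →ᵃ[ℝ] (Fin n → ℝ)) :=
  (homPolytope (cube m) (simplex n)).extremePoints ℝ

/-- `ℝ^(n + nm)`, with coordinates labeled by the single indices `i` and the double
indices `(i, k)`. -/
abbrev RealizationSpace (m n : ℕ) : Type :=
  Fin n ⊕ (Fin n × Fin m) → ℝ

/-- The standard basis vector `e_i`. -/
def e₁ {m n : ℕ} (i : Fin n) : RealizationSpace m n :=
  Pi.single (Sum.inl i) 1

/-- The standard basis vector `e_{ik}`. -/
def e₂ {m n : ℕ} (i : Fin n) (k : Fin m) : RealizationSpace m n :=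
  Pi.single (Sum.inr (i, k)) 1

/-- The points `0`, `2e_i`, `e_i + e_{ik}`, `e_i - e_{ik}` and
`(e_i + e_j) + (e_{ik} - e_{jk})` with `i ≠ j`. -/
def realizationPoints (m n : ℕ) : Set (RealizationSpace m n) :=
  {x | x = 0 ∨
    (∃ i, x = (2 : ℝ) • e₁ i) ∨
    (∃ i k, x = e₁ i + e₂ i k) ∨
    (∃ i k, x = e₁ i - e₂ i k) ∨
    (∃ i j k, i ≠ j ∧ x = (e₁ i + e₁ j) + (e₂ i k - e₂ j k))}

/-!
A point of the simplex is recorded by its `n + 1` barycentric coordinates, so an affine map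
`f : ℝ^m → ℝ^n` becomes `n + 1` affine functions with sum `1`. Scaled by `2`, their constant terms
have sum `2`, and their slopes in each of the `m` directions have sum `0` (`homCoord`). The linear
isomorphism `affineCoord` forgets the redundant coordinate at the vertex `0`.

* On the cube, a linear function has minimum minus the `ℓ¹`-norm of its coefficients. So `f` sends
  the cube into the simplex if and only if each constant term dominates the sum of the absolute
  values of the slopes (`mem_homPolytope_iff`).
* The listed points are exactly the points with constant terms `e_p + e_q` and slopes `e_p - e_q` in
  one direction, for vertices `p ≠ q` of the simplex, and the points with constant term `2 e_p` and
  no slopes (`range_labelledPoint`); this also gives their number. They satisfy the inequalities.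
* Conversely, in each direction the slopes have sum `0`, so they are a nonnegative combination of
  the vectors `e_p - e_q` that moves the positive part to the negative part (`exists_transport`).
  The same combination of the vectors `e_p + e_q` has as entries the absolute values of the slopes;
  what the constant terms have in excess of these is nonnegative and is supplied by the vectors
  `2 e_p` (`mem_convexHull_realizationPoints`).
* In homogeneous coordinates every listed point has Euclidean norm `2`. As a ball is strictly
  convex, each of them is a vertex of their convex hull
  (`extremePoints_convexHull_realizationPoints`).
-/

/-! ### Barycentric coordinates on the simplex -/

/-- The coordinates `y` completed by the entry `r - ∑ i, y i` at `none`, so that all entries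
add up to `r`. For `r = 1` these are the barycentric coordinates of `y` with respect to
`0, e₁, …, e_n`, the vertex `0` being labelled `none`. -/
def baryCoord {n : ℕ} (r : ℝ) (y : Fin n → ℝ) : Option (Fin n) → ℝ
  | none => r - ∑ i, y i
  | some i => y i

theorem sum_baryCoord {n : ℕ} (r : ℝ) (y : Fin n → ℝ) : ∑ o, baryCoord r y o = r := by
  simp [Fintype.sum_option, baryCoord]

theorem baryCoord_combo {n : ℕ} (a b r s : ℝ) (y z : Fin n → ℝ) :
    baryCoord (a * r + b * s) (a • y + b • z) = a • baryCoord r y + b • baryCoord s z := by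
  ext o
  cases o with
  | none =>
    simp only [baryCoord, Pi.add_apply, Pi.smul_apply, smul_eq_mul, Finset.sum_add_distrib,
      ← Finset.mul_sum]
    ring
  | some i => rfl

theorem baryCoord_sum_mul {n : ℕ} {ι : Type*} [Fintype ι] (r : ℝ) (c : ι → ℝ)
    (y : Fin n → ℝ) (z : ι → Fin n → ℝ) (o : Option (Fin n)) :
    baryCoord r (fun i => y i + ∑ k, z k i * c k) o =
      baryCoord r y o + ∑ k, baryCoord 0 (z k) o * c k := by
  cases o with
  | none =>
    simp only [baryCoord, Finset.sum_add_distrib, zero_sub, neg_mul, Finset.sum_neg_distrib,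
      Finset.sum_mul]
    rw [Finset.sum_comm]
    ring
  | some i => rfl

/-- The vertex of the simplex labelled `o`, among `0, e₁, …, e_n`. -/
def simplexVertex {n : ℕ} (o : Option (Fin n)) : Fin n → ℝ :=
  o.elim 0 fun i => Pi.single i 1

theorem baryCoord_simplexVertex {n : ℕ} (o : Option (Fin n)) :
    baryCoord 1 (simplexVertex o) = Pi.single o 1 := by
  ext p
  cases o <;> cases p <;> simp [baryCoord, simplexVertex, Pi.single_apply]

theorem sum_mul_simplexVertex {n : ℕ} (c : Option (Fin n) → ℝ) (i : Fin n) :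
    ∑ o, c o * simplexVertex o i = c (some i) := by
  simp [Fintype.sum_option, simplexVertex, Pi.single_apply]

theorem sum_baryCoord_smul_simplexVertex {n : ℕ} (r : ℝ) (y : Fin n → ℝ) :
    ∑ o, baryCoord r y o • simplexVertex o = y := by
  ext i
  simp only [Finset.sum_apply, Pi.smul_apply, smul_eq_mul, sum_mul_simplexVertex]
  rfl

theorem mem_simplex_iff {n : ℕ} {y : Fin n → ℝ} :
    y ∈ simplex n ↔ ∀ o, 0 ≤ baryCoord 1 y o := by
  have hS : insert 0 (Set.range fun i : Fin n => Pi.single i (1 : ℝ)) =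
      Set.range (simplexVertex (n := n)) := by
    ext z
    simp [simplexVertex, Option.exists, eq_comm]
  rw [simplex, hS]
  constructor
  · intro h o
    have hc : Convex ℝ {y : Fin n → ℝ | 0 ≤ baryCoord 1 y o} := by
      intro y hy z hz a b ha hb hab
      have e := congrFun (baryCoord_combo a b 1 1 y z) o
      rw [mul_one, mul_one, hab] at e
      change 0 ≤ baryCoord 1 (a • y + b • z) o
      rw [e]
      exact add_nonneg (mul_nonneg ha hy) (mul_nonneg hb hz)
    refine convexHull_min ?_ hc h
    rintro _ ⟨p, rfl⟩
    rw [Set.mem_ofPred_eq, baryCoord_simplexVertex, Pi.single_apply]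
    split_ifs <;> norm_num
  · intro h
    rw [← sum_baryCoord_smul_simplexVertex 1 y]
    exact (convex_convexHull ℝ _).sum_mem (fun o _ => h o) (sum_baryCoord 1 y)
      fun o _ => subset_convexHull ℝ _ ⟨o, rfl⟩

theorem convex_simplex (n : ℕ) : Convex ℝ (simplex n) := convex_convexHull ℝ _

/-! ### Coordinates of affine maps -/

/-- Column `none` of a point of `ℝ^(n + nm)` consists of its entries at the single indices,
column `some k` of those at the double indices `(i, k)`. -/
def column {m n : ℕ} (x : RealizationSpace m n) : Option (Fin m) → Fin n → ℝ
  | none => fun i => x (Sum.inl i)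
  | some k => fun i => x (Sum.inr (i, k))

theorem column_injective {m n : ℕ} : Function.Injective (column (m := m) (n := n)) := by
  intro x y h
  ext (i | ⟨i, k⟩)
  · exact congrFun (congrFun h none) i
  · exact congrFun (congrFun h (some k)) i

/-- The homogeneous coordinates of a point `x` of `ℝ^(n + nm)`: each column is completed by an
entry at `none`, so that column `none` has sum `2` and the other columns have sum `0`. -/
def homCoord {m n : ℕ} (x : RealizationSpace m n) (c : Option (Fin m)) : Option (Fin n) → ℝ :=
  baryCoord (c.elim 2 fun _ => 0) (column x c)

theorem homCoord_injective {m n : ℕ} : Function.Injective (homCoord (m := m) (n := n)) := by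
  intro x y h
  refine column_injective (funext fun c => funext fun i => ?_)
  exact congrFun (congrFun h c) (some i)

theorem homCoord_combo {m n : ℕ} (x y : RealizationSpace m n) {a b : ℝ} (hab : a + b = 1) :
    homCoord (a • x + b • y) = a • homCoord x + b • homCoord y := by
  ext1 c
  have e := baryCoord_combo a b (c.elim 2 fun _ => 0) (c.elim 2 fun _ => 0) (column x c) (column y c)
  rw [← add_mul, hab, one_mul] at e
  rw [homCoord, show column (a • x + b • y) c = a • column x c + b • column y c by
    cases c <;> rfl, e]
  rfl

/-- The coordinates of the affine map `f`, scaled by `2`: the constant term `f 0` at the single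
indices, the matrix of the linear part at the double indices. -/
noncomputable def affineCoord (m n : ℕ) :
    ((Fin m → ℝ) →ᵃ[ℝ] (Fin n → ℝ)) ≃ₗ[ℝ] RealizationSpace m n where
  toFun f := Sum.elim (fun i => 2 * f 0 i) fun p => 2 * f.linear (Pi.single p.2 1) p.1
  map_add' f g := by
    ext (i | p) <;> simp [mul_add]
  map_smul' r f := by
    ext (i | p) <;> simp <;> ring
  invFun x := (Matrix.toLin' (Matrix.of fun i k => x (Sum.inr (i, k)) / 2)).toAffineMap +
    AffineMap.const ℝ _ fun i => x (Sum.inl i) / 2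
  left_inv f := by
    refine AffineMap.ext_linear (p := 0) ?_ ?_
    · refine (Pi.basisFun ℝ (Fin m)).ext fun k => ?_
      ext i
      simp
    · ext i
      simp
  right_inv x := by
    ext (i | p) <;> simp <;> ring

theorem two_mul_apply_eq {m n : ℕ} (f : (Fin m → ℝ) →ᵃ[ℝ] (Fin n → ℝ)) (a : Fin m → ℝ)
    (i : Fin n) :
    2 * f a i = column (affineCoord m n f) none i +
      ∑ k, column (affineCoord m n f) (some k) i * a k := by
  obtain ⟨x, rfl⟩ := (affineCoord m n).symm.surjective f
  rw [LinearEquiv.apply_symm_apply]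
  simp only [affineCoord, LinearEquiv.coe_symm_mk, AffineMap.coe_add, Pi.add_apply,
    LinearMap.coe_toAffineMap, Matrix.toLin'_apply, Matrix.mulVec, dotProduct, Matrix.of_apply,
    AffineMap.coe_const, Function.const_apply, column, mul_add, Finset.mul_sum]
  rw [add_comm]
  congr 1
  · ring
  · exact Finset.sum_congr rfl fun k _ => by ring

theorem two_mul_baryCoord_apply {m n : ℕ} (f : (Fin m → ℝ) →ᵃ[ℝ] (Fin n → ℝ)) (a : Fin m → ℝ)
    (o : Option (Fin n)) :
    2 * baryCoord 1 (f a) o = homCoord (affineCoord m n f) none o +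
      ∑ k, homCoord (affineCoord m n f) (some k) o * a k := by
  have h := congrFun (baryCoord_combo 2 0 1 0 (f a) 0) o
  simp only [Pi.add_apply, Pi.smul_apply, smul_eq_mul, zero_mul, add_zero, zero_smul,
    mul_one, Pi.zero_apply, add_zero] at h
  rw [← h]
  refine Eq.trans ?_ (baryCoord_sum_mul 2 a _ _ o)
  congr 1
  ext i
  exact two_mul_apply_eq f a i

/-- An affine map sends the cube into the simplex if and only if, in each barycentric coordinate,
the constant term dominates the `ℓ¹`-norm of the linear part, since that norm is the maximum of
the linear part on the cube. -/
theorem mem_homPolytope_iff {m n : ℕ} {f : (Fin m → ℝ) →ᵃ[ℝ] (Fin n → ℝ)} :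
    f ∈ homPolytope (cube m) (simplex n) ↔
      ∀ o, ∑ k, |homCoord (affineCoord m n f) (some k) o| ≤
        homCoord (affineCoord m n f) none o := by
  constructor
  · intro h o
    -- the vertex of the cube at which the coordinate `o` is smallest
    let a : Fin m → ℝ := fun k => if 0 ≤ homCoord (affineCoord m n f) (some k) o then -1 else 1
    have ha : a ∈ cube m := subset_convexHull ℝ _ fun k => by
      by_cases hk : 0 ≤ homCoord (affineCoord m n f) (some k) o <;> simp [a, hk]
    have h1 := mem_simplex_iff.1 (h ha) o
    have h2 := two_mul_baryCoord_apply f a o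
    have h3 : ∑ k, homCoord (affineCoord m n f) (some k) o * a k =
        -∑ k, |homCoord (affineCoord m n f) (some k) o| := by
      rw [← Finset.sum_neg_distrib]
      refine Finset.sum_congr rfl fun k _ => ?_
      by_cases hk : 0 ≤ homCoord (affineCoord m n f) (some k) o
      · simp [a, hk, abs_of_nonneg hk]
      · simp [a, hk, abs_of_neg (not_le.1 hk)]
    linarith
  · intro h
    refine convexHull_min ?_ ((convex_simplex n).affine_preimage f)
    intro a ha
    refine mem_simplex_iff.2 fun o => ?_
    have h2 := two_mul_baryCoord_apply f a o
    have h3 : -∑ k, |homCoord (affineCoord m n f) (some k) o| ≤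
        ∑ k, homCoord (affineCoord m n f) (some k) o * a k := by
      rw [← Finset.sum_neg_distrib]
      refine Finset.sum_le_sum fun k _ => ?_
      rcases ha k with hk | hk <;> rw [hk]
      · rw [mul_one]; exact neg_abs_le _
      · rw [mul_neg_one]; exact neg_le_neg (le_abs_self _)
    have := h o
    linarith

/-! ### The listed points in homogeneous coordinates -/

/-- The point whose homogeneous coordinates are the sum of the unit vectors `p` and `q` in column
`none` and their difference in column `some k`. For `p = q` it corresponds to the constant map
onto a vertex of the simplex, for `p ≠ q` to the projection of the cube onto its `k`-th coordinate
followed by the parametrization of an edge. -/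
def edgePoint {m n : ℕ} (p q : Option (Fin n)) (k : Fin m) : RealizationSpace m n :=
  Sum.elim (simplexVertex p + simplexVertex q)
    fun z => if z.2 = k then (simplexVertex p - simplexVertex q) z.1 else 0

/-- The point corresponding to the constant map onto the vertex `p` of the simplex. -/
def constPoint {m n : ℕ} (p : Option (Fin n)) : RealizationSpace m n :=
  Sum.elim ((2 : ℝ) • simplexVertex p) 0

theorem edgePoint_self {m n : ℕ} (p : Option (Fin n)) (k : Fin m) :
    edgePoint p p k = constPoint p := by
  simp only [edgePoint, constPoint, two_smul, sub_self, Pi.zero_apply, ite_self]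
  rfl

theorem homCoord_constPoint {m n : ℕ} (p : Option (Fin n)) (c : Option (Fin m)) :
    homCoord (constPoint p) c = (c.elim 2 fun _ => 0 : ℝ) • Pi.single p (1 : ℝ) := by
  have h := baryCoord_combo (c.elim 2 fun _ => 0) 0 1 0 (simplexVertex p) 0
  simp only [mul_one, mul_zero, add_zero, zero_smul, baryCoord_simplexVertex] at h
  rw [← h, homCoord]
  cases c with
  | none => rfl
  | some k => simp only [Option.elim_some, zero_smul]; rfl

theorem homCoord_edgePoint_none {m n : ℕ} (p q : Option (Fin n)) (k : Fin m) :
    homCoord (edgePoint p q k) none = Pi.single p (1 : ℝ) + Pi.single q (1 : ℝ) := by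
  have h := baryCoord_combo 1 1 1 1 (simplexVertex p) (simplexVertex q)
  simp only [one_smul, baryCoord_simplexVertex, mul_one, one_add_one_eq_two] at h
  exact h

theorem homCoord_edgePoint_some {m n : ℕ} (p q : Option (Fin n)) (k l : Fin m) :
    homCoord (edgePoint p q k) (some l) =
      if l = k then Pi.single p (1 : ℝ) - Pi.single q (1 : ℝ) else 0 := by
  split_ifs with hl
  · have h := baryCoord_combo 1 (-1) 1 1 (simplexVertex p) (simplexVertex q)
    simp only [one_smul, neg_smul, baryCoord_simplexVertex, mul_one, ← sub_eq_add_neg,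
      sub_self] at h
    rw [← h, homCoord]
    congr 1
    ext i
    simp [column, edgePoint, hl]
  · ext o
    cases o <;> simp [homCoord, column, edgePoint, hl, baryCoord]

theorem constPoint_mem {m n : ℕ} (p : Option (Fin n)) :
    constPoint p ∈ realizationPoints m n := by
  cases p with
  | none =>
    left
    ext (i | z) <;> simp [constPoint, simplexVertex]
  | some i =>
    right; left
    refine ⟨i, ?_⟩
    ext (j | z) <;> simp [constPoint, simplexVertex, e₁, Pi.single_apply]

theorem edgePoint_some_none {m n : ℕ} (i : Fin n) (k : Fin m) :
    edgePoint (some i) none k = e₁ i + e₂ i k := by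
  ext (j | ⟨j, l⟩)
  · simp [edgePoint, simplexVertex, e₁, e₂, Pi.single_apply]
  · by_cases hl : l = k <;> simp [edgePoint, simplexVertex, e₁, e₂, Pi.single_apply, hl]

theorem edgePoint_none_some {m n : ℕ} (i : Fin n) (k : Fin m) :
    edgePoint none (some i) k = e₁ i - e₂ i k := by
  ext (j | ⟨j, l⟩)
  · simp [edgePoint, simplexVertex, e₁, e₂, Pi.single_apply]
  · by_cases hl : l = k <;> simp [edgePoint, simplexVertex, e₁, e₂, Pi.single_apply, hl]

theorem edgePoint_some_some {m n : ℕ} (i j : Fin n) (k : Fin m) :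
    edgePoint (some i) (some j) k = (e₁ i + e₁ j) + (e₂ i k - e₂ j k) := by
  ext (j | ⟨j, l⟩)
  · simp [edgePoint, simplexVertex, e₁, e₂, Pi.single_apply]
  · by_cases hl : l = k <;> simp [edgePoint, simplexVertex, e₁, e₂, Pi.single_apply, hl]

theorem edgePoint_mem {m n : ℕ} (p q : Option (Fin n)) (k : Fin m) :
    edgePoint p q k ∈ realizationPoints m n := by
  by_cases hpq : p = q
  · rw [hpq, edgePoint_self]
    exact constPoint_mem q
  rcases p with _ | i <;> rcases q with _ | j
  · exact absurd rfl hpq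
  · exact Or.inr (Or.inr (Or.inr (Or.inl ⟨j, k, edgePoint_none_some j k⟩)))
  · exact Or.inr (Or.inr (Or.inl ⟨i, k, edgePoint_some_none i k⟩))
  · exact Or.inr (Or.inr (Or.inr (Or.inr
      ⟨i, j, k, fun h => hpq (congrArg some h), edgePoint_some_some i j k⟩)))

/-- The listed points, labelled by the vertices of the simplex and by the pairs of an ordered
edge of the simplex and a coordinate of the cube. -/
def labelledPoint (m n : ℕ) :
    Option (Fin n) ⊕ {z : Option (Fin n) × Option (Fin n) // z.1 ≠ z.2} × Fin m →
      RealizationSpace m n :=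
  Sum.elim constPoint fun z => edgePoint z.1.1.1 z.1.1.2 z.2

theorem range_labelledPoint (m n : ℕ) :
    Set.range (labelledPoint m n) = realizationPoints m n := by
  apply Set.Subset.antisymm
  · rintro _ ⟨p | z, rfl⟩
    · exact constPoint_mem p
    · exact edgePoint_mem _ _ _
  · rintro x (rfl | ⟨i, rfl⟩ | ⟨i, k, rfl⟩ | ⟨i, k, rfl⟩ | ⟨i, j, k, hij, rfl⟩)
    · refine ⟨Sum.inl none, ?_⟩
      ext (j | z) <;> simp [labelledPoint, constPoint, simplexVertex]
    · refine ⟨Sum.inl (some i), ?_⟩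
      ext (j | z) <;> simp [labelledPoint, constPoint, simplexVertex, e₁, Pi.single_apply]
    · exact ⟨Sum.inr (⟨(some i, none), by simp⟩, k), edgePoint_some_none i k⟩
    · exact ⟨Sum.inr (⟨(none, some i), by simp⟩, k), edgePoint_none_some i k⟩
    · exact ⟨Sum.inr (⟨(some i, some j), by simpa using hij⟩, k), edgePoint_some_some i j k⟩

theorem edgePoint_injective {m n : ℕ} {p q p' q' : Option (Fin n)} {k k' : Fin m} (hpq : p ≠ q)
    (h : edgePoint p q k = edgePoint p' q' k') : p = p' ∧ q = q' ∧ k = k' := by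
  have hk := congrFun (congrArg homCoord h) (some k)
  rw [homCoord_edgePoint_some, homCoord_edgePoint_some, if_pos rfl] at hk
  have h1 := congrFun hk p
  have h2 := congrFun hk q
  by_cases hkk : k = k'
  · refine ⟨?_, ?_, hkk⟩
    · by_contra hp
      simp only [hkk, if_true, Pi.sub_apply, Pi.single_apply, hpq, hp, if_false] at h1
      split_ifs at h1 <;> norm_num at h1
    · by_contra hq
      simp only [hkk, if_true, Pi.sub_apply, Pi.single_apply, hpq.symm, hq, if_false] at h2
      split_ifs at h2 <;> norm_num at h2
  · simp [hkk, hpq] at h1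

theorem constPoint_ne_edgePoint {m n : ℕ} (r : Option (Fin n)) {p q : Option (Fin n)}
    (hpq : p ≠ q) (k : Fin m) : constPoint r ≠ edgePoint p q k := by
  intro h
  have hk := congrFun (congrFun (congrArg homCoord h) (some k)) p
  rw [homCoord_edgePoint_some, homCoord_constPoint] at hk
  simp [hpq] at hk

theorem constPoint_injective {m n : ℕ} :
    Function.Injective (constPoint (m := m) (n := n)) := by
  intro p q h
  by_contra hpq
  have hk := congrFun (congrFun (congrArg homCoord h) none) p
  rw [homCoord_constPoint, homCoord_constPoint] at hk
  simp [hpq] at hk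

theorem labelledPoint_injective (m n : ℕ) : Function.Injective (labelledPoint m n) := by
  refine constPoint_injective.sumElim ?_ fun r z => constPoint_ne_edgePoint r z.1.2 z.2
  rintro ⟨⟨⟨p, q⟩, hpq⟩, k⟩ ⟨⟨⟨p', q'⟩, hpq'⟩, k'⟩ h
  obtain ⟨rfl, rfl, rfl⟩ := edgePoint_injective hpq h
  rfl

theorem ncard_realizationPoints (m n : ℕ) :
    (realizationPoints m n).ncard = (n + 1) * (m * n + 1) := by
  have hcard : Fintype.card {z : Option (Fin n) × Option (Fin n) // z.1 ≠ z.2} =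
      (n + 1) * n := by
    rw [Fintype.card_subtype, show (Finset.univ.filter fun z : Option (Fin n) × Option (Fin n) =>
      z.1 ≠ z.2) = (Finset.univ : Finset (Option (Fin n))).offDiag by ext; simp,
      Finset.offDiag_card]
    simp [← Nat.mul_sub_one]
  rw [← range_labelledPoint, ← Set.image_univ,
    Set.ncard_image_of_injective _ (labelledPoint_injective m n), Set.ncard_univ,
    Nat.card_eq_fintype_card, Fintype.card_sum, Fintype.card_prod, hcard]
  simp only [Fintype.card_option, Fintype.card_fin]
  ring

/-! ### The listed points are extreme -/

/-- The homogeneous coordinates as a point of a Euclidean space. -/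
def euclideanCoord {m n : ℕ} (x : RealizationSpace m n) :
    EuclideanSpace ℝ (Option (Fin m) × Option (Fin n)) :=
  WithLp.toLp 2 fun z => homCoord x z.1 z.2

theorem euclideanCoord_injective {m n : ℕ} :
    Function.Injective (euclideanCoord (m := m) (n := n)) := by
  intro x y h
  refine homCoord_injective (funext fun c => funext fun o => ?_)
  exact congrArg (fun v : EuclideanSpace ℝ _ => v (c, o)) h

theorem euclideanCoord_combo {m n : ℕ} (x y : RealizationSpace m n) {a b : ℝ}
    (hab : a + b = 1) :
    euclideanCoord (a • x + b • y) = a • euclideanCoord x + b • euclideanCoord y := by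
  ext z
  exact congrFun (congrFun (homCoord_combo x y hab) z.1) z.2

theorem norm_euclideanCoord {m n : ℕ} {x : RealizationSpace m n}
    (hx : x ∈ realizationPoints m n) : ‖euclideanCoord x‖ = 2 := by
  rw [← sq_eq_sq₀ (norm_nonneg _) zero_le_two, EuclideanSpace.real_norm_sq_eq,
    Fintype.sum_prod_type, Fintype.sum_option]
  rw [← range_labelledPoint] at hx
  obtain ⟨p | ⟨⟨⟨p, q⟩, hpq⟩, k⟩, rfl⟩ := hx
  · simp only [labelledPoint, Sum.elim_inl, euclideanCoord, homCoord_constPoint]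
    simp [Pi.single_apply]
  · have hadd (o : Option (Fin n)) :
        ((Pi.single p 1 + Pi.single q 1 : Option (Fin n) → ℝ) o) ^ 2 =
          (if o = p then 1 else 0) + if o = q then 1 else 0 := by
      by_cases hp : o = p <;> by_cases hq : o = q <;> simp_all
    have hsub (o : Option (Fin n)) (l : Fin m) :
        ((if l = k then Pi.single p 1 - Pi.single q 1 else 0 : Option (Fin n) → ℝ) o) ^ 2 =
          if l = k then (if o = p then 1 else 0) + if o = q then 1 else 0 else 0 := by
      by_cases hl : l = k <;> by_cases hp : o = p <;> by_cases hq : o = q <;>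
        simp_all
    simp only [labelledPoint, Sum.elim_inr, euclideanCoord, homCoord_edgePoint_none,
      homCoord_edgePoint_some, hadd, hsub]
    rw [Finset.sum_comm (s := (Finset.univ : Finset (Fin m)))]
    simp [Finset.sum_add_distrib]
    norm_num

/-- The listed points lie on a sphere in homogeneous coordinates, and the Euclidean ball is
strictly convex, so none of them is superfluous for their convex hull. -/
theorem extremePoints_convexHull_realizationPoints (m n : ℕ) :
    (convexHull ℝ (realizationPoints m n)).extremePoints ℝ = realizationPoints m n := by
  refine Set.Subset.antisymm extremePoints_convexHull_subset fun x hx => ?_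
  have hball : convexHull ℝ (realizationPoints m n) ⊆
      euclideanCoord ⁻¹' Metric.closedBall 0 2 := by
    refine convexHull_min (fun y hy => ?_) fun y hy z hz a b ha hb hab => ?_
    · simp [norm_euclideanCoord hy]
    · rw [Set.mem_preimage, euclideanCoord_combo y z hab]
      exact convex_closedBall _ _ hy hz ha hb hab
  have hext : euclideanCoord x ∈ (Metric.closedBall
      (0 : EuclideanSpace ℝ (Option (Fin m) × Option (Fin n))) 2).extremePoints ℝ :=
    StrictConvexSpace.sphere_subset_extremePoints_closedBall _ two_ne_zero
      (by simp [norm_euclideanCoord hx])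
  refine mem_extremePoints_iff_left.2 ⟨subset_convexHull ℝ _ hx, ?_⟩
  rintro y hy z hz ⟨a, b, ha, hb, hab, rfl⟩
  refine euclideanCoord_injective ((mem_extremePoints_iff_left.1 hext).2 _ (hball hy) _
    (hball hz) ⟨a, b, ha, hb, hab, ?_⟩)
  exact (euclideanCoord_combo y z hab).symm

/-! ### Decomposition into listed points -/

open scoped PosPart in
/-- A finite real family with sum `0` is the net balance of a transport from its positive part to
its negative part. -/
theorem exists_transport {ι : Type*} [Fintype ι] (a : ι → ℝ) (ha : ∑ i, a i = 0) :
    ∃ t : ι → ι → ℝ, (∀ i j, 0 ≤ t i j) ∧ (∀ i, ∑ j, t i j = (a i)⁺) ∧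
      ∀ j, ∑ i, t i j = (a j)⁻ := by
  have hS : ∑ i, (a i)⁺ = ∑ i, (a i)⁻ := by
    rw [← sub_eq_zero, ← Finset.sum_sub_distrib, ← ha]
    exact Finset.sum_congr rfl fun i _ => posPart_sub_negPart (a i)
  -- the product coupling; if the total mass is `0`, then so is every entry
  refine ⟨fun i j => (a i)⁺ * (a j)⁻ / ∑ i, (a i)⁺, fun i j => ?_, fun i => ?_, fun j => ?_⟩
  · exact div_nonneg (mul_nonneg (posPart_nonneg _) (negPart_nonneg _))
      (Finset.sum_nonneg fun i _ => posPart_nonneg _)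
  · rw [← Finset.sum_div, ← Finset.mul_sum, ← hS]
    refine mul_div_cancel_of_imp fun h => ?_
    exact (Finset.sum_eq_zero_iff_of_nonneg fun i _ => posPart_nonneg (a i)).1 h i
      (Finset.mem_univ i)
  · rw [← Finset.sum_div, ← Finset.sum_mul]
    refine mul_div_cancel_left_of_imp fun h => ?_
    exact (Finset.sum_eq_zero_iff_of_nonneg fun i _ => negPart_nonneg (a i)).1 (hS ▸ h) j
      (Finset.mem_univ j)

/-- A point with dominated slopes is a convex combination of the listed points: each column of
slopes is a transport between the vertices of the simplex, hence a combination of edge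
directions, and what remains of the constant term is a combination of vertices. -/
theorem mem_convexHull_realizationPoints {m n : ℕ} {x : RealizationSpace m n}
    (hx : ∀ o, ∑ k, |homCoord x (some k) o| ≤ homCoord x none o) :
    x ∈ convexHull ℝ (realizationPoints m n) := by
  choose t ht0 htr htc using fun k : Fin m =>
    exists_transport (homCoord x (some k)) (sum_baryCoord 0 _)
  -- the excess is halved because the constant term of `constPoint p` is `2 e_p`
  let w : Option (Fin n) ⊕ (Fin m × Option (Fin n) × Option (Fin n)) → ℝ :=
    Sum.elim (fun o => (homCoord x none o - ∑ k, |homCoord x (some k) o|) / 2)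
      fun z => t z.1 z.2.1 z.2.2
  let v : Option (Fin n) ⊕ (Fin m × Option (Fin n) × Option (Fin n)) → RealizationSpace m n :=
    Sum.elim constPoint fun z => edgePoint z.2.1 z.2.2 z.1
  have habs (k o) : ∑ p, t k o p + ∑ p, t k p o = |homCoord x (some k) o| := by
    rw [htr, htc, posPart_add_negPart]
  have hnone : ∑ o, homCoord x none o = 2 := sum_baryCoord 2 _
  have hw0 : ∀ z, 0 ≤ w z := by
    rintro (o | z)
    · exact div_nonneg (sub_nonneg.2 (hx o)) zero_le_two
    · exact ht0 _ _ _
  have hw1 : ∑ z, w z = 1 := by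
    have h1 (k) : ∑ o, |homCoord x (some k) o| = 2 * ∑ p, ∑ q, t k p q := by
      simp only [← habs, Finset.sum_add_distrib]
      rw [Finset.sum_comm (f := fun o p => t k p o)]
      ring
    simp only [w, Fintype.sum_sum_type, Sum.elim_inl, Sum.elim_inr, Fintype.sum_prod_type,
      ← Finset.sum_div, Finset.sum_sub_distrib, hnone]
    rw [Finset.sum_comm]
    simp only [h1, ← Finset.mul_sum]
    ring
  have hwv : ∑ z, w z • v z = x := by
    simp only [w, v, Fintype.sum_sum_type, Sum.elim_inl, Sum.elim_inr, Fintype.sum_prod_type]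
    have hr (k i) : ∑ p, ∑ q, t k p q * simplexVertex p i = ∑ q, t k (some i) q := by
      simp only [← Finset.sum_mul, sum_mul_simplexVertex]
    ext (i | ⟨i, l⟩)
    · simp only [Pi.add_apply, Finset.sum_apply, Pi.smul_apply, constPoint, edgePoint,
        Sum.elim_inl, smul_eq_mul, mul_add, Finset.sum_add_distrib, hr, ← mul_assoc,
        div_mul_cancel₀ _ (two_ne_zero (α := ℝ)), sum_mul_simplexVertex]
      rw [← Finset.sum_add_distrib]
      simp only [habs, sub_add_cancel]
      rfl
    · simp only [Pi.add_apply, Finset.sum_apply, Pi.smul_apply, constPoint, edgePoint,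
        Sum.elim_inr, smul_eq_mul, Pi.zero_apply, mul_zero, Finset.sum_const_zero, zero_add,
        mul_ite, Pi.sub_apply, mul_sub]
      rw [Finset.sum_eq_single l (fun k _ hk => by simp [hk.symm]) (by simp)]
      simp only [if_true, Finset.sum_sub_distrib, hr, sum_mul_simplexVertex, htr, htc,
        posPart_sub_negPart]
      rfl
  rw [← hwv]
  refine (convex_convexHull ℝ _).sum_mem (fun z _ => hw0 z) hw1 fun z _ =>
    subset_convexHull ℝ _ ?_
  rcases z with o | z
  · exact constPoint_mem o
  · exact edgePoint_mem _ _ _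

theorem convex_homPolytope {V W : Type*} [AddCommGroup V] [Module ℝ V] [AddCommGroup W]
    [Module ℝ W] (P : Set V) {Q : Set W} (hQ : Convex ℝ Q) : Convex ℝ (homPolytope P Q) :=
  fun _ hf _ hg _ _ ha hb hab _ hx => hQ (hf hx) (hg hx) ha hb hab

theorem image_homPolytope (m n : ℕ) :
    affineCoord m n '' homPolytope (cube m) (simplex n) =
      convexHull ℝ (realizationPoints m n) := by
  apply Set.Subset.antisymm
  · rintro _ ⟨f, hf, rfl⟩
    exact mem_convexHull_realizationPoints (mem_homPolytope_iff.1 hf)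
  · refine convexHull_min (fun x hx => ⟨(affineCoord m n).symm x, ?_, by simp⟩)
      ((convex_homPolytope _ (convex_simplex n)).linear_image (affineCoord m n).toLinearMap)
    rw [mem_homPolytope_iff, LinearEquiv.apply_symm_apply]
    rw [← range_labelledPoint] at hx
    intro o
    obtain ⟨p | ⟨⟨⟨p, q⟩, hpq⟩, k⟩, rfl⟩ := hx
    · simp only [labelledPoint, Sum.elim_inl, homCoord_constPoint]
      by_cases hp : o = p <;> simp [hp]
    · simp only [labelledPoint, Sum.elim_inr, homCoord_edgePoint_none, homCoord_edgePoint_some]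
      rw [Finset.sum_eq_single k (fun l _ hl => by simp [hl]) (by simp)]
      by_cases hp : o = p <;> by_cases hq : o = q <;> simp_all

/-- `Hom(□_m, △_n)` has `(n+1)(mn+1)` vertices, and some isomorphism of polytopes (induced by an
affine isomorphism of the ambient spaces) carries `Hom(□_m, △_n)` onto the convex hull of the listed
points, and its vertex set onto exactly the set of these points. -/
theorem corollary4p2 (m n : ℕ) :
    (vert m n).ncard = (n + 1) * (m * n + 1) ∧
    ∃ Φ : ((Fin m → ℝ) →ᵃ[ℝ] (Fin n → ℝ)) ≃ᵃ[ℝ] RealizationSpace m n,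
      Φ '' homPolytope (cube m) (simplex n) = convexHull ℝ (realizationPoints m n) ∧
      Φ '' vert m n = realizationPoints m n := by
  have hv : affineCoord m n '' vert m n = realizationPoints m n := by
    rw [vert, image_extremePoints (affineCoord m n), image_homPolytope,
      extremePoints_convexHull_realizationPoints]
  refine ⟨?_, (affineCoord m n).toAffineEquiv, image_homPolytope m n, hv⟩
  rw [← ncard_realizationPoints, ← hv,
    Set.ncard_image_of_injective _ (affineCoord m n).injective]
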